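/- For all natural numbers $n \ge 2$ and $m < 2^n$ there is a sequence $\vec R = \langle R_0,\dots,R_{n-1}\rangle$ of subsets of $\omega$ with the following property. For every partition $A_0,\dots,A_{m-1}$ of $\omega$ (pieces may be empty) such that each $A_j$ is arithmetical in $\vec R$, there are a $j < m$ and an infinite set $B \subseteq A_j$ such that no set $C$ that is Turing computable from $B$ is $\vec R$-cohesive. Here a set $A \subseteq \omega$ is arithmetical in $\vec R$ if it is definable, by a first-order formula with one free variable, over the structure $(\omega, 0, 1, +, \cdot, \le, R_0,\dots,R_{n-1})$, and a set $S \subseteq \omega$ is $\vec R$-cohesive if it is infinite and for each $k < n$ at least one of $S \cap R_k$ and $S \cap (\omega \setminus R_k)$ is finite. -/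

import Mathlib

open FirstOrder

namespace CohesiveAvoidance

/-- The function symbols `0`, `1`, `+`, `·` of first-order arithmetic. -/
inductive ArithFunc : ℕ → Type
  | zero : ArithFunc 0
  | one : ArithFunc 0
  | add : ArithFunc 2
  | mul : ArithFunc 2

/-- The relation symbols of arithmetic with `n` set parameters: the order `≤`, and one unary
predicate (membership in the `k`-th set parameter) for each `k < n`. -/
inductive ArithRel (n : ℕ) : ℕ → Type
  | le : ArithRel n 2
  | mem (k : Fin n) : ArithRel n 1

/-- The language of first-order arithmetic with `n` set parameters. -/
def arithLanguage (n : ℕ) : Language where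
  Functions := ArithFunc
  Relations := ArithRel n

/-- The standard structure `(ω, 0, 1, +, ·, ≤, R 0, …, R (n-1))`. -/
@[reducible]
def arithStructure {n : ℕ} (R : Fin n → Set ℕ) : (arithLanguage n).Structure ℕ where
  funMap := fun {_} f => match f with
    | .zero => fun _ => 0
    | .one => fun _ => 1
    | .add => fun v => v 0 + v 1
    | .mul => fun v => v 0 * v 1
  RelMap := fun {_} r => match r with
    | .le => fun v => v 0 ≤ v 1
    | .mem k => fun v => v 0 ∈ R k

/-- `A` is arithmetical in `R = ⟨R 0, …, R (n-1)⟩`: it is defined over the standard structure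
`(ω, 0, 1, +, ·, ≤, R 0, …, R (n-1))` by a first-order formula with one free variable. -/
def ArithmeticalIn {n : ℕ} (R : Fin n → Set ℕ) (A : Set ℕ) : Prop :=
  letI := arithStructure R
  ∃ φ : (arithLanguage n).Formula Unit, ∀ x : ℕ, x ∈ A ↔ φ.Realize (fun _ => x)

/-- The characteristic function of a set of natural numbers (a total function, regarded as a
partial one). -/
noncomputable def charFn (S : Set ℕ) : ℕ →. ℕ :=
  ((S.indicator (fun _ => 1) : ℕ → ℕ) : ℕ →. ℕ)

/-- The set `S` computes the set `T`, i.e. `T` is Turing reducible to `S`. -/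
def Computes (S T : Set ℕ) : Prop :=
  TuringReducible (charFn T) (charFn S)

/-- `S` is cohesive for the sequence `R`. -/
def IsCohesive {ι : Type*} (R : ι → Set ℕ) (S : Set ℕ) : Prop :=
  S.Infinite ∧ ∀ i, (S ∩ R i).Finite ∨ (S ∩ (R i)ᶜ).Finite

/-- `A` is a partition of `ω` (into pairwise disjoint, possibly empty, pieces). -/
def IsPartition {m : ℕ} (A : Fin m → Set ℕ) : Prop :=
  (∀ i j, i ≠ j → Disjoint (A i) (A j)) ∧ ⋃ j, A j = Set.univ

end CohesiveAvoidance

/-! View `R` as a coloring `c` of ω by the 2^n subsets of `Fin n`; a cohesive set has almost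
constant color. It suffices that any cover with fewer pieces than colors has a piece with an
infinite subset at which every oracle operator has a finite or not almost monochromatic value
(`exists_coloring_forall_cover`).

The coloring is fixed before the cover. For each reservoir in a countable class, either a splitting
bounds the operators' values or, by compactness, every splitting yields a late element below a fixed
bound; `c` gives whole intervals up to such bounds any prescribed color
(`exists_reservoirs_and_coloring`).

Given a cover, Mathias conditions build one candidate per relevant piece. Elements already forced
into the values miss some color `k`; the dichotomy makes one value finite or adds an element of
color `k` to it (`exists_extends_diagonalizes`). Each stage meets one entry of a tuple of
requirements, so some piece meets all of its own. -/

namespace CohesiveAvoidance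

open Filter

/-! ### Oracle computations and the use principle -/

/-- Codes for partial functions recursive in an oracle. -/
inductive OracleCode : Type
  | zero | succ | left | right | oracle
  | pair (a b : OracleCode)
  | comp (a b : OracleCode)
  | prec (a b : OracleCode)
  | rfind (a : OracleCode)
  deriving Countable

namespace OracleCode

/-- The partial function with a given code, relative to the oracle `o`. -/
def eval (o : ℕ →. ℕ) : OracleCode → ℕ →. ℕ
  | zero => fun _ => 0
  | succ => Nat.succ
  | left => fun n => (Nat.unpair n).1
  | right => fun n => (Nat.unpair n).2
  | oracle => o
  | pair a b => fun n => Nat.pair <$> a.eval o n <*> b.eval o n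
  | comp a b => fun n => b.eval o n >>= a.eval o
  | prec a b => fun p =>
      let (x, n) := Nat.unpair p
      n.rec (a.eval o x) fun y IH => do
        let i ← IH
        b.eval o (Nat.pair x (Nat.pair y i))
  | rfind a => fun x => Nat.rfind fun n => (fun m => m = 0) <$> a.eval o (Nat.pair x n)

theorem exists_eval_eq {o f : ℕ →. ℕ} (hf : Nat.RecursiveIn {o} f) :
    ∃ c : OracleCode, c.eval o = f := by
  induction hf with
  | zero => exact ⟨zero, rfl⟩
  | succ => exact ⟨succ, rfl⟩
  | left => exact ⟨left, rfl⟩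
  | right => exact ⟨right, rfl⟩
  | oracle g hg => exact ⟨oracle, hg.symm⟩
  | pair _ _ iha ihb =>
    obtain ⟨a, rfl⟩ := iha
    obtain ⟨b, rfl⟩ := ihb
    exact ⟨pair a b, rfl⟩
  | comp _ _ iha ihb =>
    obtain ⟨a, rfl⟩ := iha
    obtain ⟨b, rfl⟩ := ihb
    exact ⟨comp a b, rfl⟩
  | prec _ _ iha ihb =>
    obtain ⟨a, rfl⟩ := iha
    obtain ⟨b, rfl⟩ := ihb
    exact ⟨prec a b, rfl⟩
  | rfind _ iha =>
    obtain ⟨a, rfl⟩ := iha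
    exact ⟨rfind a, rfl⟩

/-- The use principle: a convergent computation consults only a finite part of the oracle. -/
theorem eventually_mem_eval {o : ℕ →. ℕ} (c : OracleCode) {x v : ℕ} (h : v ∈ c.eval o x) :
    ∀ᶠ N in atTop, ∀ o' : ℕ →. ℕ, (∀ i < N, o i = o' i) → v ∈ c.eval o' x := by
  induction c generalizing x v with
  | zero | succ | left | right => exact .of_forall fun _ _ _ => h
  | oracle =>
    filter_upwards [eventually_gt_atTop x] with N hN o' ho'
    simpa only [eval, ← ho' x hN] using h
  | pair a b iha ihb =>
    simp only [eval, Seq.seq, Part.map_eq_map, Part.mem_bind_iff,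
      Part.mem_map_iff] at h ⊢
    obtain ⟨_, ⟨u, hu, rfl⟩, w, hw, rfl⟩ := h
    filter_upwards [iha hu, ihb hw] with N h₁ h₂ o' ho'
    exact ⟨_, ⟨u, h₁ o' ho', rfl⟩, w, h₂ o' ho', rfl⟩
  | comp a b iha ihb =>
    obtain ⟨u, hu, hv⟩ := Part.mem_bind_iff.1 h
    filter_upwards [ihb hu, iha hv] with N h₁ h₂ o' ho'
    exact Part.mem_bind_iff.2 ⟨u, h₁ o' ho', h₂ o' ho'⟩
  | prec a b iha ihb =>
    simp only [eval] at h ⊢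
    generalize (Nat.unpair x).2 = n at h ⊢
    induction n generalizing v with
    | zero => exact iha h
    | succ n ih =>
      simp only [Part.bind_eq_bind, Part.mem_bind_iff] at h ⊢
      obtain ⟨u, hu, hv⟩ := h
      filter_upwards [ih hu, ihb hv] with N h₁ h₂ o' ho'
      exact ⟨u, h₁ o' ho', h₂ o' ho'⟩
  | rfind a iha =>
    obtain ⟨h0, h⟩ := Nat.mem_rfind.1 h
    obtain ⟨u, hu, hu0⟩ := (Part.mem_map_iff _).1 h0
    have h' : ∀ᶠ N in atTop, ∀ i ∈ Set.Iio v, ∀ o' : ℕ →. ℕ, (∀ i < N, o i = o' i) →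
        ∃ w ∈ a.eval o' (Nat.pair x i), decide (w = 0) = false := by
      rw [eventually_all_finite (Set.finite_Iio v)]
      intro i hi
      obtain ⟨w, hw, hw0⟩ := (Part.mem_map_iff _).1 (h hi)
      filter_upwards [iha hw] with N h₁ o' ho'
      exact ⟨w, h₁ o' ho', hw0⟩
    filter_upwards [iha hu, h'] with N h₁ h₂ o' ho'
    exact Nat.mem_rfind.2 ⟨(Part.mem_map_iff _).2 ⟨u, h₁ o' ho', hu0⟩,
      fun hi => (Part.mem_map_iff _).2 (h₂ _ hi o' ho')⟩

/-- The set accepted by the computation with a given code from the oracle `B`. -/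
def accepted (c : OracleCode) (B : Set ℕ) : Set ℕ := {x | 1 ∈ c.eval (charFn B) x}

theorem exists_accepted_eq {B C : Set ℕ} (h : Computes B C) :
    ∃ c : OracleCode, c.accepted B = C := by
  obtain ⟨c, hc⟩ := exists_eval_eq (RecursiveIn.iff_nat.1 h)
  refine ⟨c, Set.ext fun x => ?_⟩
  rw [accepted, Set.mem_ofPred_eq, hc]
  by_cases hx : x ∈ C <;> simp [charFn, hx]

/-- This continuity and the countability of codes are all that the combinatorics needs from
computability. -/
theorem exists_use_accepted (c : OracleCode) (B : Set ℕ) {x : ℕ} (hx : x ∈ c.accepted B) :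
    ∃ N, ∀ B' : Set ℕ, (∀ i < N, i ∈ B ↔ i ∈ B') → x ∈ c.accepted B' := by
  obtain ⟨N, hN⟩ := (c.eventually_mem_eval hx).exists
  refine ⟨N, fun B' h => hN _ fun i hi => ?_⟩
  by_cases hB : i ∈ B
  · simp [charFn, hB, (h i hi).1 hB]
  · simp [charFn, hB, mt (h i hi).2 hB]

end OracleCode

/-! ### Interval colorings and countable closures -/

/-- There is a coloring that, for each of countably many bounds `g i` and each color `k`, is
constantly `k` on arbitrarily late intervals `[l, g i l)`. -/
theorem exists_coloring_const_on_intervals {ι κ : Type*} [Countable ι] [Countable κ] [Nonempty κ]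
    (g : ι → ℕ → ℕ) :
    ∃ c : ℕ → κ, ∀ i k T, ∃ l ≥ T, ∀ x, l ≤ x → x < g i l → c x = k := by
  rcases isEmpty_or_nonempty ι with _ | _
  · exact ⟨fun _ => Classical.arbitrary κ, fun i => isEmptyElim i⟩
  obtain ⟨f, hf⟩ := exists_surjective_nat (ι × κ × ℕ)
  -- Block `[a s, a (s + 1))` serves the triple `f s = (i, k, T)`: it reaches up to `g i l` for `l =
  -- max (a s) T`.
  obtain ⟨a, ha⟩ : ∃ a : ℕ → ℕ,
      ∀ s, a (s + 1) = a s + 1 + g (f s).1 (max (a s) (f s).2.2) :=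
    ⟨fun s => Nat.rec (motive := fun _ => ℕ) 0
      (fun s l => l + 1 + g (f s).1 (max l (f s).2.2)) s, fun _ => rfl⟩
  have ha_mono : StrictMono a := strictMono_nat_of_lt_succ fun s => by rw [ha]; omega
  let c : ℕ → κ := fun x => (f (Classical.epsilon fun s : ℕ => a s ≤ x ∧ x < a (s + 1))).2.1
  have hc : ∀ s x, a s ≤ x → x < a (s + 1) → c x = (f s).2.1 := by
    intro s x h₁ h₂
    have h₃ := Classical.epsilon_spec (p := fun s : ℕ => a s ≤ x ∧ x < a (s + 1)) ⟨s, h₁, h₂⟩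
    have h₄ := ha_mono.lt_iff_lt.1 (h₁.trans_lt h₃.2)
    have h₅ := ha_mono.lt_iff_lt.1 (h₃.1.trans_lt h₂)
    exact congrArg (fun s => (f s).2.1) (by omega)
  refine ⟨c, fun i k T => ?_⟩
  obtain ⟨s, hs⟩ := hf (i, k, T)
  have has := ha s
  simp only [hs] at has
  refine ⟨max (a s) T, le_max_right _ _, fun x h₁ h₂ => ?_⟩
  rw [hc s x ((le_max_left _ _).trans h₁) (by omega), hs]

/-- A countable family of unary operations has a countable closed set containing a given point. -/
theorem exists_countable_closed {α β : Type*} [Countable α] (op : α → β → β) (b : β) :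
    ∃ M : Set β, M.Countable ∧ b ∈ M ∧ ∀ a, ∀ x ∈ M, op a x ∈ M := by
  refine ⟨Set.range fun l : List α => l.foldr op b, Set.countable_range _, ⟨[], rfl⟩, ?_⟩
  rintro a _ ⟨l, rfl⟩
  exact ⟨a :: l, rfl⟩

/-! ### Avoiding splittings and compactness -/

section Combinatorics

variable {ι α κ : Type*}

/-- The splitting `z` of the reservoir `X` into the pieces `X ∩ z ⁻¹' {j}` for `j ∈ J` is such
that no finite subset of the `j`-th piece, added to `E j`, puts a number `≥ l` into the value of
the operator `W (e j)`. -/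
def IsAvoidingSplit (W : ι → Set ℕ → Set ℕ) (X : Set ℕ) (E : α → Finset ℕ) (e : α → ι)
    (J : Finset α) (l : ℕ) (z : ℕ → α) : Prop :=
  (∀ x ∈ X, z x ∈ J) ∧ ∀ j ∈ J, ∀ F : Finset ℕ, (∀ x ∈ F, x ∈ X ∧ z x = j) →
    ∀ y ∈ W (e j) (E j ∪ F), y < l

/-- Compactness: if no splitting is avoiding, this is witnessed below a fixed bound. -/
theorem exists_bound_of_forall_not_isAvoidingSplit [Finite α] (W : ι → Set ℕ → Set ℕ) (X : Set ℕ)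
    (E : α → Finset ℕ) (e : α → ι) (J : Finset α) (l : ℕ)
    (h : ∀ z, ¬ IsAvoidingSplit W X E e J l z) :
    ∃ N, ∀ z : ℕ → α, (∀ x ∈ X, z x ∈ J) → ∃ j ∈ J, ∃ F : Finset ℕ, (∀ x ∈ F, x ∈ X ∧ z x = j) ∧
      ∃ y ∈ W (e j) (E j ∪ F), l ≤ y ∧ y < N := by
  by_contra! H
  choose z hz hz' using H
  -- Since `α` is finite, the counterexamples `z N` converge pointwise along a nonprincipal
  -- ultrafilter.
  have lim : ∀ x, ∃ i, ∀ᶠ N in (hyperfilter ℕ : Filter ℕ), z N x = i := fun x =>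
    Ultrafilter.eventually_exists_iff.1 (.of_forall fun N => ⟨z N x, rfl⟩)
  choose z' hlim using lim
  refine h z' ⟨fun x hx => ?_, fun j hj F hF y hy => ?_⟩
  · obtain ⟨N, hN⟩ := (hlim x).exists
    exact hN ▸ hz N x hx
  · by_contra! hly
    have h₁ : ∀ᶠ N in (hyperfilter ℕ : Filter ℕ), ∀ x ∈ F, z N x = z' x :=
      (eventually_all_finset F).2 fun x _ => hlim x
    have h₂ : ∀ᶠ N in (hyperfilter ℕ : Filter ℕ), y < N :=
      Nat.hyperfilter_le_atTop (eventually_gt_atTop y)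
    obtain ⟨N, h₁, h₂⟩ := (h₁.and h₂).exists
    exact (hz' N j hj F (fun x hx => ⟨(hF x hx).1, (h₁ x hx).trans (hF x hx).2⟩) y hy hly).not_gt h₂

/-- The reservoirs and the coloring against which any cover can be diagonalized. -/
theorem exists_reservoirs_and_coloring [Finite α] [Countable ι] [Finite κ] [Nonempty κ]
    (W : ι → Set ℕ → Set ℕ) :
    ∃ (M : Set (Set ℕ)) (c : ℕ → κ), Set.univ ∈ M ∧ (∀ X ∈ M, ∀ N, X ∩ Set.Ici N ∈ M) ∧
      ∀ X ∈ M, ∀ (E : α → Finset ℕ) (e : α → ι) (J : Finset α),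
        (∃ l z, IsAvoidingSplit W X E e J l z ∧ ∀ j, X ∩ z ⁻¹' {j} ∈ M) ∨
        ∀ k T, ∃ l ≥ T, ∀ z : ℕ → α, (∀ x ∈ X, z x ∈ J) → ∃ j ∈ J, ∃ F : Finset ℕ,
          (∀ x ∈ F, x ∈ X ∧ z x = j) ∧ ∃ y ∈ W (e j) (E j ∪ F), l ≤ y ∧ c y = k := by
  classical
  -- One avoiding splitting is chosen per parameter tuple; there are countably many tuples, so
  -- closing under the pieces keeps `M` countable.
  let op : ℕ ⊕ (((α → Finset ℕ) × (α → ι) × Finset α × ℕ) × α) → Set ℕ → Set ℕ := fun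
    | .inl N => fun X => X ∩ Set.Ici N
    | .inr ((E, e, J, l), j) => fun X =>
      {x ∈ X | ∃ h : ∃ z, IsAvoidingSplit W X E e J l z, h.choose x = j}
  obtain ⟨M, hM, hM_univ, hM_op⟩ := exists_countable_closed op Set.univ
  have := hM.to_subtype
  have bound : ∀ i : M × (α → Finset ℕ) × (α → ι) × Finset α, ∀ l, ∃ N,
      (∀ z, ¬ IsAvoidingSplit W i.1 i.2.1 i.2.2.1 i.2.2.2 l z) →
      ∀ z : ℕ → α, (∀ x ∈ i.1.1, z x ∈ i.2.2.2) → ∃ j ∈ i.2.2.2, ∃ F : Finset ℕ,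
        (∀ x ∈ F, x ∈ i.1.1 ∧ z x = j) ∧
        ∃ y ∈ W (i.2.2.1 j) (i.2.1 j ∪ F), l ≤ y ∧ y < N := by
    rintro ⟨X, E, e, J⟩ l
    by_cases h : ∀ z, ¬ IsAvoidingSplit W X E e J l z
    · obtain ⟨N, hN⟩ := exists_bound_of_forall_not_isAvoidingSplit W X E e J l h
      exact ⟨N, fun _ => hN⟩
    · exact ⟨0, fun h' => absurd h' h⟩
  choose g hg using bound
  obtain ⟨c, hc⟩ := exists_coloring_const_on_intervals (κ := κ) g
  refine ⟨M, c, hM_univ, fun X hX N => hM_op (.inl N) X hX, fun X hX E e J => ?_⟩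
  by_cases h : ∃ l z, IsAvoidingSplit W X E e J l z
  · obtain ⟨l, hz⟩ := h
    refine .inl ⟨l, hz.choose, hz.choose_spec, fun j => ?_⟩
    convert hM_op (.inr ((E, e, J, l), j)) X hX using 1
    ext x
    simp [op, hz]
  · push Not at h
    refine .inr fun k T => ?_
    obtain ⟨l, hlT, hl⟩ := hc (⟨X, hX⟩, E, e, J) k T
    refine ⟨l, hlT, fun z hz => ?_⟩
    obtain ⟨j, hj, F, hF, y, hy, hly, hyg⟩ := hg (⟨X, hX⟩, E, e, J) l (h l) z hz
    exact ⟨j, hj, F, hF, y, hy, hly, hl y hly hyg⟩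

end Combinatorics

/-! ### Mathias forcing with disjunctive requirements -/

section Mathias

variable {ι α κ : Type*}

/-- A Mathias condition with a common reservoir and one stem for each member of a family. -/
structure MathiasCondition (α : Type*) where
  stem : α → Finset ℕ
  reservoir : Set ℕ

namespace MathiasCondition

variable {A : α → Set ℕ} {p q r : MathiasCondition α} {j : α} {B : Set ℕ}

/-- `B` extends the `j`-th stem by elements of the reservoir lying in `A j`. -/
def Compatible (A : α → Set ℕ) (p : MathiasCondition α) (j : α) (B : Set ℕ) : Prop :=
  ↑(p.stem j) ⊆ B ∧ B ⊆ ↑(p.stem j) ∪ (p.reservoir ∩ A j)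

/-- `q` is a stronger condition than `p`, for the construction of subsets of the `A j`. -/
def Extends (A : α → Set ℕ) (q p : MathiasCondition α) : Prop :=
  q.reservoir ⊆ p.reservoir ∧ ∀ j, p.Compatible A j (q.stem j)

theorem Extends.compatible (h : q.Extends A p) (hB : q.Compatible A j B) : p.Compatible A j B := by
  refine ⟨(h.2 j).1.trans hB.1, fun x hx => ?_⟩
  rcases hB.2 hx with hx | hx
  · exact (h.2 j).2 hx
  · exact .inr ⟨h.1 hx.1, hx.2⟩

theorem compatible_stem (p : MathiasCondition α) (j : α) : p.Compatible A j (p.stem j) :=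
  ⟨subset_rfl, Set.subset_union_left⟩

theorem Extends.refl (p : MathiasCondition α) : p.Extends A p :=
  ⟨subset_rfl, p.compatible_stem⟩

theorem Extends.trans (h : r.Extends A q) (h' : q.Extends A p) : r.Extends A p :=
  ⟨h.1.trans h'.1, fun j => h'.compatible (h.2 j)⟩

/-- The condition with new stems, and with the reservoir restricted to numbers `≥ N`. -/
def restem (p : MathiasCondition α) (F : α → Finset ℕ) (N : ℕ) : MathiasCondition α :=
  ⟨F, p.reservoir ∩ Set.Ici N⟩

theorem restem_extends {F : α → Finset ℕ} (h : ∀ j, p.Compatible A j (F j)) (N : ℕ) :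
    (p.restem F N).Extends A p :=
  ⟨Set.inter_subset_left, h⟩

/-- Elements added later are at least `N`, so computations with use `N` are preserved. -/
theorem Compatible.mem_iff_of_restem {F : α → Finset ℕ} {N : ℕ}
    (h : (p.restem F N).Compatible A j B) {i : ℕ} (hi : i < N) : i ∈ F j ↔ i ∈ B := by
  refine ⟨fun hF => h.1 hF, fun hB => ?_⟩
  rcases h.2 hB with h | h
  · exact h
  · exact absurd hi h.1.2.not_gt

/-- The reservoir is an infinite subset of `X` from the class `M`. -/
def Admissible (M : Set (Set ℕ)) (X : Set ℕ) (p : MathiasCondition α) : Prop :=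
  p.reservoir ∈ M ∧ p.reservoir ⊆ X ∧ p.reservoir.Infinite

theorem Admissible.restem {M : Set (Set ℕ)} {X : Set ℕ} (h : p.Admissible M X)
    (hM : ∀ X ∈ M, ∀ N, X ∩ Set.Ici N ∈ M) (F : α → Finset ℕ) (N : ℕ) :
    (p.restem F N).Admissible M X := by
  refine ⟨hM _ h.1 N, Set.inter_subset_left.trans h.2.1, ?_⟩
  refine (h.2.2.sdiff (Set.finite_Iio N)).mono fun x hx => ⟨hx.1, ?_⟩
  simpa using hx.2

end MathiasCondition

open MathiasCondition

/-- The value of the operator `W e` at `B` is finite, or the coloring `c` is not constant on its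
elements `≥ t`. -/
def Diagonalizes (W : ι → Set ℕ → Set ℕ) (c : ℕ → κ) (e : ι) (t : ℕ) (B : Set ℕ) : Prop :=
  ¬ ((W e B).Infinite ∧ ∃ k, ∀ x ∈ W e B, t ≤ x → c x = k)

variable {W : ι → Set ℕ → Set ℕ} {M : Set (Set ℕ)} {c : ℕ → κ} {A : α → Set ℕ} {X : Set ℕ}
  {J : Finset α}

/-- Keeps the limit sets infinite: by `hJ` the reservoir offers late elements of each piece in `J`.
-/
theorem exists_extends_forall_exists_mem_stem
    (hM : ∀ X ∈ M, ∀ N, X ∩ Set.Ici N ∈ M)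
    (hJ : ∀ Y ∈ M, Y ⊆ X → Y.Infinite → ∀ j ∈ J, (Y ∩ A j).Infinite)
    {p : MathiasCondition α} (hp : p.Admissible M X) (s : ℕ) :
    ∃ q : MathiasCondition α, q.Admissible M X ∧ q.Extends A p ∧
      ∀ j ∈ J, ∃ b ∈ q.stem j, s ≤ b := by
  classical
  have : ∀ j, ∃ F : Finset ℕ, p.Compatible A j F ∧ (j ∈ J → ∃ b ∈ F, s ≤ b) := by
    intro j
    by_cases hj : j ∈ J
    · obtain ⟨b, hb, hsb⟩ := (hJ _ hp.1 hp.2.1 hp.2.2 j hj).exists_gt s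
      refine ⟨insert b (p.stem j), ⟨by simp, ?_⟩, fun _ => ⟨b, by simp, hsb.le⟩⟩
      rw [Finset.coe_insert, Set.insert_subset_iff]
      exact ⟨.inr hb, Set.subset_union_left⟩
    · exact ⟨p.stem j, p.compatible_stem j, fun h => absurd h hj⟩
  choose F hF hF' using this
  exact ⟨p.restem F 0, hp.restem hM F 0, restem_extends hF 0, hF'⟩

/-- If each operator takes an infinite value at some compatible set, then a stronger condition forces
late elements into the values of all operators simultaneously. -/
theorem exists_extends_forall_mem [Finite α]
    (hW : ∀ e B, ∀ y ∈ W e B, ∃ N, ∀ B' : Set ℕ, (∀ i < N, i ∈ B ↔ i ∈ B') → y ∈ W e B')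
    (hM : ∀ X ∈ M, ∀ N, X ∩ Set.Ici N ∈ M)
    {p : MathiasCondition α} (hp : p.Admissible M X) (e : α → ι) (t : α → ℕ)
    (h : ∀ j ∈ J, ∃ B, p.Compatible A j B ∧ (W (e j) B).Infinite) :
    ∃ q : MathiasCondition α, q.Admissible M X ∧ q.Extends A p ∧ ∃ y : α → ℕ,
      ∀ j ∈ J, t j ≤ y j ∧ ∀ B, q.Compatible A j B → y j ∈ W (e j) B := by
  classical
  have := Fintype.ofFinite α
  have : ∀ j, ∃ (F : Finset ℕ) (y N : ℕ), p.Compatible A j F ∧ (j ∈ J → t j ≤ y ∧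
      ∀ B' : Set ℕ, (∀ i < N, i ∈ F ↔ i ∈ B') → y ∈ W (e j) B') := by
    intro j
    by_cases hj : j ∈ J
    · obtain ⟨B, hB, hinf⟩ := h j hj
      obtain ⟨y, hy, hty⟩ := hinf.exists_gt (t j)
      obtain ⟨N, hN⟩ := hW _ _ y hy
      refine ⟨p.stem j ∪ {i ∈ Finset.range N | i ∈ B}, y, N, ⟨by simp, ?_⟩, fun _ => ⟨hty.le,
        fun B' h' => hN B' fun i hi => ?_⟩⟩
      · intro i hi
        simp only [Finset.coe_union, Finset.coe_filter, Set.mem_union] at hi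
        exact hi.elim .inl fun hi => hB.2 hi.2
      · rw [← h' i hi]
        have := @hB.1 i
        simp only [Finset.mem_coe] at this
        simp only [Finset.mem_union, Finset.mem_filter, Finset.mem_range]
        tauto
    · exact ⟨p.stem j, 0, 0, p.compatible_stem j, fun h => absurd h hj⟩
  choose F y N hF hy using this
  refine ⟨p.restem F (Finset.univ.sup N), hp.restem hM _ _, restem_extends hF _, y, fun j hj =>
    ⟨(hy j hj).1, fun B hB => (hy j hj).2 B fun i hi => hB.mem_iff_of_restem ?_⟩⟩
  exact hi.trans_le (Finset.le_sup (f := N) (Finset.mem_univ j))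

/-- A stronger condition meets the requirement of at least one piece: either an avoiding splitting
makes the value of its operator finite, or its value gets late elements of two colors. -/
theorem exists_extends_diagonalizes [Finite α] [Finite κ] (hcard : Nat.card α < Nat.card κ)
    (hW : ∀ e B, ∀ y ∈ W e B, ∃ N, ∀ B' : Set ℕ, (∀ i < N, i ∈ B ↔ i ∈ B') → y ∈ W e B')
    (hM : ∀ X ∈ M, ∀ N, X ∩ Set.Ici N ∈ M)
    (hMc : ∀ X ∈ M, ∀ (E : α → Finset ℕ) (e : α → ι) (J : Finset α),
      (∃ l z, IsAvoidingSplit W X E e J l z ∧ ∀ j, X ∩ z ⁻¹' {j} ∈ M) ∨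
      ∀ k T, ∃ l ≥ T, ∀ z : ℕ → α, (∀ x ∈ X, z x ∈ J) → ∃ j ∈ J, ∃ F : Finset ℕ,
        (∀ x ∈ F, x ∈ X ∧ z x = j) ∧ ∃ y ∈ W (e j) (E j ∪ F), l ≤ y ∧ c y = k)
    (hX : ∀ x ∈ X, ∃ j ∈ J, x ∈ A j)
    {p : MathiasCondition α} (hp : p.Admissible M X) (e : α → ι) (t : α → ℕ) :
    ∃ q : MathiasCondition α, q.Admissible M X ∧ q.Extends A p ∧
      ∃ j ∈ J, ∀ B, q.Compatible A j B → Diagonalizes W c (e j) (t j) B := by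
  classical
  have := Fintype.ofFinite α
  by_contra! H
  obtain ⟨q, hq, hqp, y, hy⟩ := exists_extends_forall_mem hW hM hp e t (J := J) (A := A)
    fun j hj => by
      obtain ⟨B, hB, hB'⟩ := H p hp (.refl p) j hj
      exact ⟨B, hB, (not_not.1 hB').1⟩
  obtain ⟨k, hk⟩ : ∃ k, ∀ j, c (y j) ≠ k := by
    by_contra! h
    exact hcard.not_ge (Nat.card_le_card_of_surjective (fun j => c (y j)) h)
  rcases hMc _ hq.1 q.stem e J with ⟨l, z, ⟨hzJ, hz⟩, hzM⟩ | hgen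
  -- Shrinking the reservoir to an infinite part of the splitting bounds the `j`-th value by `l`.
  · obtain ⟨j, hj, hinf⟩ : ∃ j ∈ J, (q.reservoir ∩ z ⁻¹' {j}).Infinite := by
      by_contra! h
      refine hq.2.2 ((J.finite_toSet.biUnion fun j hj => h j hj).subset
        fun x hx => ?_)
      exact Set.mem_biUnion (hzJ x hx) ⟨hx, rfl⟩
    let r : MathiasCondition α := ⟨q.stem, q.reservoir ∩ z ⁻¹' {j}⟩
    have hrq : r.Extends A q := ⟨Set.inter_subset_left, q.compatible_stem⟩
    obtain ⟨B, hB, hB'⟩ := H r ⟨hzM j, Set.inter_subset_left.trans hq.2.1, hinf⟩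
      (hrq.trans hqp) j hj
    obtain ⟨x, hx, hlx⟩ := (not_not.1 hB').1.exists_gt l
    obtain ⟨N, hN⟩ := hW _ _ x hx
    let F : Finset ℕ := {i ∈ Finset.range N | i ∈ B ∧ i ∈ r.reservoir}
    refine hlx.not_gt (hz j hj F (fun i hi => (Finset.mem_filter.1 hi).2.2) x
      (hN _ fun i hi => ?_))
    have h₁ : i ∈ q.stem j → i ∈ B := fun h => hB.1 h
    have h₂ : i ∈ B → i ∈ q.stem j ∨ i ∈ r.reservoir := fun h => (hB.2 h).imp id And.left
    simp only [F, Set.mem_union, Finset.mem_coe, Finset.mem_filter, Finset.mem_range]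
    tauto
  -- Split the reservoir along `A` itself: the resulting `F` lies in `A j` and brings in color `k`,
  -- which differs from that of `y j`.
  · obtain ⟨l, hl, hgen⟩ := hgen k (Finset.univ.sup t)
    have : ∀ x, ∃ j, x ∈ q.reservoir → j ∈ J ∧ x ∈ A j := by
      intro x
      by_cases hx : x ∈ q.reservoir
      · obtain ⟨j, hj⟩ := hX x (hq.2.1 hx)
        exact ⟨j, fun _ => hj⟩
      · obtain ⟨x', hx'⟩ := hq.2.2.nonempty
        obtain ⟨j, -⟩ := hX x' (hq.2.1 hx')
        exact ⟨j, fun h => absurd h hx⟩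
    choose z hz using this
    obtain ⟨j, hj, F, hF, x, hx, hlx, hxk⟩ := hgen z fun x hx => (hz x hx).1
    obtain ⟨N, hN⟩ := hW _ _ x hx
    let G : α → Finset ℕ := Function.update q.stem j (q.stem j ∪ F)
    have hG : ∀ i, q.Compatible A i (G i) := by
      intro i
      by_cases hij : i = j
      · subst hij
        simp only [G, Function.update_self, Finset.coe_union]
        refine ⟨Set.subset_union_left, Set.union_subset_union_right _ fun b hb => ?_⟩
        obtain ⟨h₁, h₂⟩ := hF b hb
        exact ⟨h₁, h₂ ▸ (hz b h₁).2⟩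
      · simpa only [G, Function.update_of_ne hij] using q.compatible_stem i
    have hrq := restem_extends hG N
    obtain ⟨B, hB, hB'⟩ := H _ (hq.restem hM G N) (hrq.trans hqp) j hj
    obtain ⟨-, k', hk'⟩ := not_not.1 hB'
    have h₁ := hk' _ ((hy j hj).2 B (hrq.compatible hB)) (hy j hj).1
    have h₂ := hk' x (hN B fun i hi => by
      rw [← hB.mem_iff_of_restem hi]
      simp [G]) (((Finset.le_sup (f := t) (Finset.mem_univ j)).trans hl).trans hlx)
    exact hk j (h₁.trans (h₂.symm.trans hxk))

/-- For more colors than pieces, and countably many continuous operators, there is a coloring such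
that every cover has a piece with an infinite subset at which each operator takes a value that is
finite or not almost homogeneous. -/
theorem exists_coloring_forall_cover [Finite α] [Countable ι] [Finite κ]
    (hcard : Nat.card α < Nat.card κ)
    (hW : ∀ e B, ∀ y ∈ W e B, ∃ N, ∀ B' : Set ℕ, (∀ i < N, i ∈ B ↔ i ∈ B') → y ∈ W e B') :
    ∃ c : ℕ → κ, ∀ A : α → Set ℕ, ⋃ j, A j = Set.univ →
      ∃ j, ∃ B ⊆ A j, B.Infinite ∧ ∀ e t, Diagonalizes W c e t B := by
  classical
  have := Fintype.ofFinite α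
  have : Nonempty κ := (Nat.card_pos_iff.1 (Nat.zero_le _ |>.trans_lt hcard)).1
  obtain ⟨M, c, hM_univ, hM, hMc⟩ := exists_reservoirs_and_coloring (κ := κ) (α := α) W
  refine ⟨c, fun A hA => ?_⟩
  have hcover : ∃ J : Finset α, ∃ X ∈ M, X.Infinite ∧ ∀ x ∈ X, ∃ j ∈ J, x ∈ A j :=
    ⟨Finset.univ, Set.univ, hM_univ, Set.infinite_univ, fun x _ => by
      simpa using Set.mem_iUnion.1 (hA ▸ Set.mem_univ x)⟩
  -- With `J` minimal, no piece in `J` can be dropped by passing to a tail of a smaller reservoir.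
  obtain ⟨J, ⟨X, hXM, hX_inf, hX⟩, hmin⟩ := WellFounded.has_min
    (Finset.isWellFounded_ssubset (α := α)).wf {J | _} hcover
  have hJ : ∀ Y ∈ M, Y ⊆ X → Y.Infinite → ∀ j ∈ J, (Y ∩ A j).Infinite := by
    intro Y hYM hYX hY j hj hfin
    obtain ⟨N, hN⟩ := hfin.bddAbove
    refine hmin (J.erase j) ⟨Y ∩ Set.Ici (N + 1), hM Y hYM _, ?_, fun x hx => ?_⟩
      (Finset.erase_ssubset hj)
    · refine (hY.sdiff (Set.finite_Iio (N + 1))).mono fun x hx => ⟨hx.1, ?_⟩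
      simpa using hx.2
    · obtain ⟨i, hi, hxi⟩ := hX x (hYX hx.1)
      refine ⟨i, Finset.mem_erase.2 ⟨?_, hi⟩, hxi⟩
      rintro rfl
      exact absurd (hN ⟨hx.1, hxi⟩) (Nat.lt_of_succ_le hx.2).not_ge
  obtain ⟨j₀, hj₀⟩ : J.Nonempty := by
    obtain ⟨x, hx⟩ := hX_inf.nonempty
    obtain ⟨j, hj, -⟩ := hX x hx
    exact ⟨j, hj⟩
  by_contra! H
  obtain ⟨e₀, -⟩ : ∃ e : ι, True := by
    by_contra! h
    obtain ⟨e, -⟩ := H j₀ (X ∩ A j₀) Set.inter_subset_right (hJ X hXM subset_rfl hX_inf j₀ hj₀)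
    exact h e
  -- Whole tuples are listed, since the piece that a stage serves cannot be prescribed.
  obtain ⟨f, hf⟩ : ∃ f : ℕ → α → ι × ℕ, Function.Surjective f :=
    have : Nonempty (α → ι × ℕ) := ⟨fun _ => (e₀, 0)⟩
    exists_surjective_nat _
  have step : ∀ s (p : {p : MathiasCondition α // p.Admissible M X}),
      ∃ q : {p : MathiasCondition α // p.Admissible M X}, q.1.Extends A p.1 ∧
        (∀ j ∈ J, ∃ b ∈ q.1.stem j, s ≤ b) ∧
        ∃ j ∈ J, ∀ B, q.1.Compatible A j B → Diagonalizes W c (f s j).1 (f s j).2 B := by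
    intro s p
    obtain ⟨q, hq, hqp, hqs⟩ := exists_extends_forall_exists_mem_stem hM hJ p.2 s
    obtain ⟨r, hr, hrq, hrs⟩ := exists_extends_diagonalizes hcard hW hM hMc hX hq
      (fun j => (f s j).1) (fun j => (f s j).2)
    refine ⟨⟨r, hr⟩, hrq.trans hqp, fun j hj => ?_, hrs⟩
    obtain ⟨b, hb, hsb⟩ := hqs j hj
    exact ⟨b, (hrq.2 j).1 hb, hsb⟩
  choose next hext hinf hdiag using step
  obtain ⟨P, hP0, hP⟩ : ∃ P : ℕ → {p : MathiasCondition α // p.Admissible M X},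
      P 0 = ⟨⟨fun _ => ∅, X⟩, hXM, subset_rfl, hX_inf⟩ ∧ ∀ s, P (s + 1) = next s (P s) :=
    ⟨fun s => Nat.rec (motive := fun _ => _) _ next s, rfl, fun _ => rfl⟩
  have hP_ext : ∀ s s', s ≤ s' → (P s').1.Extends A (P s).1 := fun s s' h =>
    Nat.le_induction (Extends.refl _) (fun n _ ih => (hP n ▸ hext n (P n)).trans ih) s' h
  let B : α → Set ℕ := fun j => ⋃ s, ((P s).1.stem j : Set ℕ)
  have hB : ∀ s j, (P s).1.Compatible A j (B j) := by
    refine fun s j => ⟨Set.subset_iUnion_of_subset s subset_rfl, Set.iUnion_subset fun s' => ?_⟩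
    rcases le_total s s' with h | h
    · exact ((hP_ext s s' h).2 j).2
    · exact ((hP_ext s' s h).2 j).1.trans Set.subset_union_left
  have hBA : ∀ j, B j ⊆ A j := fun j x hx => by
    have := (hB 0 j).2 hx
    rw [hP0] at this
    simpa using And.right (by simpa using this : x ∈ X ∧ x ∈ A j)
  have hB_inf : ∀ j ∈ J, (B j).Infinite := by
    refine fun j hj => Set.infinite_of_not_bddAbove ?_
    rintro ⟨N, hN⟩
    obtain ⟨b, hb, hNb⟩ := hinf (N + 1) (P (N + 1)) j hj
    rw [← hP] at hb
    have := hN (Set.mem_iUnion.2 ⟨_, hb⟩)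
    omega
  -- One failed requirement per piece forms a tuple `f s`, contradicting stage `s`.
  have hfail : ∀ j, ∃ i : ι × ℕ, j ∈ J → ¬ Diagonalizes W c i.1 i.2 (B j) := by
    intro j
    by_cases hj : j ∈ J
    · obtain ⟨e, t, h⟩ := H j (B j) (hBA j) (hB_inf j hj)
      exact ⟨(e, t), fun _ => h⟩
    · exact ⟨(e₀, 0), fun h => absurd h hj⟩
  choose g hg using hfail
  obtain ⟨s, rfl⟩ := hf g
  obtain ⟨j, hj, h⟩ := hdiag s (P s)
  exact hg j hj (h _ (hP s ▸ hB (s + 1) j))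

end Mathias

end CohesiveAvoidance

/-! ### From colorings to cohesive sets -/

theorem theorem1p4 (n m : ℕ) (hn : 2 ≤ n) (hm : m < 2 ^ n) :
    ∃ R : Fin n → Set ℕ, ∀ A : Fin m → Set ℕ,
      CohesiveAvoidance.IsPartition A →
      (∀ j, CohesiveAvoidance.ArithmeticalIn R (A j)) →
      ∃ j : Fin m, ∃ B : Set ℕ, B ⊆ A j ∧ B.Infinite ∧
        ∀ C : Set ℕ, CohesiveAvoidance.Computes B C →
          ¬ CohesiveAvoidance.IsCohesive R C := by
  obtain ⟨c, hc⟩ := CohesiveAvoidance.exists_coloring_forall_cover (α := Fin m)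
    (κ := Set (Fin n)) (W := CohesiveAvoidance.OracleCode.accepted) (by simpa using hm)
    fun e B y hy => e.exists_use_accepted B hy
  refine ⟨fun k => {x | k ∈ c x}, fun A hA _ => ?_⟩
  obtain ⟨j, B, hBA, hB, hdiag⟩ := hc A hA.2
  refine ⟨j, B, hBA, hB, fun C hC hcoh => ?_⟩
  obtain ⟨e, rfl⟩ := CohesiveAvoidance.OracleCode.exists_accepted_eq hC
  set C := e.accepted B
  -- The color on which `C` settles.
  let K : Set (Fin n) := {k | (C ∩ {x | k ∈ c x}ᶜ).Finite}
  have hfin : {x ∈ C | c x ≠ K}.Finite := by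
    have h : ∀ k, {x ∈ C | ¬ (k ∈ c x ↔ k ∈ K)}.Finite := by
      intro k
      by_cases hk : k ∈ K
      · refine Set.Finite.subset hk fun x hx => ⟨hx.1, fun h => hx.2 (iff_of_true h hk)⟩
      · refine ((hcoh.2 k).resolve_right hk).subset fun x hx => ⟨hx.1, ?_⟩
        by_contra h
        exact hx.2 (iff_of_false h hk)
    refine (Set.finite_iUnion h).subset fun x hx => ?_
    obtain ⟨k, hk⟩ := not_forall.1 (mt Set.ext hx.2)
    exact Set.mem_iUnion.2 ⟨k, hx.1, hk⟩
  obtain ⟨N, hN⟩ := hfin.bddAbove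
  refine hdiag e (N + 1) ⟨hcoh.1, K, fun x hx hNx => ?_⟩
  by_contra h
  exact absurd (hN ⟨hx, h⟩) (Nat.lt_of_succ_le hNx).not_ge
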